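/- For nonzero integers $a,b$ let $L(a,b)=(L_n)_{n\ge 0}$ be the Lucas sequence of the first kind: $L_0=0$, $L_1=1$, $L_n=aL_{n-1}+bL_{n-2}$ for $n\ge 2$. Its characteristic polynomial is $x^2-ax-b$, with discriminant $D=a^2+4b$; $F=(F_n)=L(1,1)$ is the Fibonacci sequence. The rank of appearance $\alpha_L(p)$ of a prime $p$ in $L$ is the least $n\ge 1$ with $p\mid L_n$. A prime $p$ is a Wall–Sun–Sun prime if $p^2\mid F_{\alpha_F(p)}$. Theorem. Let $p\ge 3$ be a prime. (1) Let $L=L(a,1)$ with $a$ a nonzero integer, $D=a^2+4$, and suppose $\alpha_L(p)>2$. Let $\lambda_1,\lambda_2$ be the roots of $x^2-ax-1$ in an algebraic closure of $\mathbf Q_p$ (with the absolute value extending $|\cdot|_p$), and let $K=\mathbf Q_p(\sqrt D)$. Let $\pi$ be an element of $K$ with $|\pi|_p=p^{-1/2}$ if $K$ contains such an element (i.e. if $K/\mathbf Q_p$ is ramified), and $\pi=p$ otherwise (including the case $K=\mathbf Q_p$). Let $l$ be the order of $\lambda_2/\lambda_1$ modulo $\pi$, i.e. the least $l\ge1$ such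 that $\pi$ divides $(\lambda_2/\lambda_1)^l-1$ in the ring of integers $O_K$ of $K$. If $p^2\mid D$, or $(\lambda_2/\lambda_1)^l-1$ is not divisible by $\pi^2$ in $O_K$, then $$\overline{\left\{\frac{L_{n+\alpha_L(p)}}{L_n} : n\ge 0,\ L_n\neq 0\right\}}\ \cup\ \overline{\left\{\frac{L_{n+\alpha_L(p)-2}}{L_n} : n\ge 0,\ L_n\ne 0\right\}}=\mathbf Q_p,$$ where the closures are taken in $\mathbf Q_p$. (2) In particular, if $p$ is not a Wall–Sun–Sun prime, then $$\overline{\left\{\frac{F_{n+\alpha_F(p)}}{F_n} : n\ge 0,\ F_n\neq 0\right\}}\ \cup\ \overline{\left\{\frac{F_{n+\alpha_F(p)-2}}{F_n} : n\ge 0,\ F_n\ne 0\right\}}=\mathbf Q_p.$$ -/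

import Mathlib

/-- The Lucas sequence of the first kind `L(a,b)`: `L 0 = 0`, `L 1 = 1`,
`L (n+2) = a * L (n+1) + b * L n`. -/
def lucasSeq (a b : ℤ) : ℕ → ℤ
  | 0 => 0
  | 1 => 1
  | n + 2 => a * lucasSeq a b (n + 1) + b * lucasSeq a b n

/-- The characteristic polynomial `X ^ 2 - a X - b` of `L(a,b)`. -/
noncomputable def lucasCharpoly (a b : ℤ) : Polynomial ℤ :=
  Polynomial.X ^ 2 - Polynomial.C a * Polynomial.X - Polynomial.C b

/-- The discriminant `a ^ 2 + 4 b` of the characteristic polynomial of `L(a,b)`. -/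
def lucasDisc (a b : ℤ) : ℤ := a ^ 2 + 4 * b

/-- The Fibonacci sequence, as a sequence of integers. -/
def fibSeq (n : ℕ) : ℤ := (Nat.fib n : ℤ)

/-- The rank of appearance of `p` in `u`: the smallest positive `n` such that `p ∣ u n`.
(The value is `0` if there is no such `n`; this never happens for the sequences `L(a,1)`
and for the Fibonacci sequence.) -/
noncomputable def rankOfAppearance (u : ℕ → ℤ) (p : ℕ) : ℕ :=
  sInf {n : ℕ | 0 < n ∧ (p : ℤ) ∣ u n}

/-- `p` is a Wall-Sun-Sun prime: `p ^ 2` divides the term of the Fibonacci sequence whose index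
is the rank of appearance of `p`. -/
def IsWallSunSun (p : ℕ) : Prop :=
  p.Prime ∧ (p : ℤ) ^ 2 ∣ fibSeq (rankOfAppearance fibSeq p)

/-- The closure in `ℚ_[p]` of the set of all ratios `u (n + m) / u n` with `u n ≠ 0`. -/
def ratioClosure (p : ℕ) [Fact p.Prime] (u : ℕ → ℤ) (m : ℕ) : Set ℚ_[p] :=
  closure {x : ℚ_[p] | ∃ n : ℕ, u n ≠ 0 ∧ x = (u (n + m) : ℚ_[p]) / (u n : ℚ_[p])}

/-- The field `ℚ_p(√D)`, inside the algebraic closure of `ℚ_[p]` (whose norm extends the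
`p`-adic absolute value, `‖p‖ = 1 / p`). -/
noncomputable def quadField (p : ℕ) [Fact p.Prime] (D : ℤ) :
    IntermediateField ℚ_[p] (PadicAlgCl p) :=
  IntermediateField.adjoin ℚ_[p] {x : PadicAlgCl p | x ^ 2 = (D : PadicAlgCl p)}

/-- `K` is ramified (for `K = ℚ_p` or `K` quadratic over `ℚ_p`): it has an element of absolute
value `p ^ (-1/2)`. -/
def IsRamifiedQuad {p : ℕ} [Fact p.Prime] (K : IntermediateField ℚ_[p] (PadicAlgCl p)) : Prop :=
  ∃ x ∈ K, ‖x‖ ^ 2 = (p : ℝ)⁻¹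

/-- `π` is an admissible uniformizer of `K`: any element of `K` of absolute value `p ^ (-1/2)` in
the ramified case, and `p` otherwise. -/
def IsQuadUniformizer {p : ℕ} [Fact p.Prime] (K : IntermediateField ℚ_[p] (PadicAlgCl p))
    (π : PadicAlgCl p) : Prop :=
  π ∈ K ∧ (IsRamifiedQuad K → ‖π‖ ^ 2 = (p : ℝ)⁻¹) ∧
    (¬ IsRamifiedQuad K → π = (p : PadicAlgCl p))

/-- `y` is divisible by `x` with respect to the ring of integers `{z ∈ K | ‖z‖ ≤ 1}` of `K`. -/
def IntDvd {p : ℕ} [Fact p.Prime] (K : IntermediateField ℚ_[p] (PadicAlgCl p))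
    (x y : PadicAlgCl p) : Prop :=
  ∃ z ∈ K, ‖z‖ ≤ 1 ∧ y = x * z

/-- The order of `x` modulo `π`: the least `l > 0` such that `π` divides `x ^ l - 1` in the
ring of integers of `K`. -/
noncomputable def orderModulo {p : ℕ} [Fact p.Prime]
    (K : IntermediateField ℚ_[p] (PadicAlgCl p)) (π x : PadicAlgCl p) : ℕ :=
  sInf {l : ℕ | 0 < l ∧ IntDvd K π (x ^ l - 1)}

/-! Write `r` for the rank. Everything reduces to `p` dividing `L_r` exactly once. In that case the
quotients `t = L_{kr} / L_{kr+1}` are dense in the open unit disc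
(`mem_closure_range_lucasSeq_div`). By the addition formula, `L_{n+r} / L_n = L_{r-1} + L_r / t` at
`n = kr`, and `L_{n+r-2} / L_n = L_{r-1} + L_{r-2} t` at `n = kr + 1`. As `|L_r| < 1` and `|L_{r-2}|
= 1`, the first family approximates every `y` with `|y - L_{r-1}| ≥ 1`, and the second fills the
disc `|y - L_{r-1}| < 1`.

Exact divisibility is automatic when `p ∣ D`. Otherwise `|(λ₂/λ₁)^n - 1| = |L_n|`, so `p ^ 2 ∣ L_r`
would force `l = r` and make `π ^ 2` divide `(λ₂/λ₁)^l - 1`. -/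

/-! ### Addition formulas and expansions of `L_{mn}` -/

theorem lucasSeq_add_succ (a : ℤ) (m n : ℕ) :
    lucasSeq a 1 (m + n + 1) =
      lucasSeq a 1 (m + 1) * lucasSeq a 1 (n + 1) + lucasSeq a 1 m * lucasSeq a 1 n := by
  induction m generalizing n with
  | zero => simp [lucasSeq]
  | succ m ih =>
    have h := ih (n + 1)
    rw [show m + 1 + n + 1 = m + (n + 1) + 1 by ring, h]
    simp only [lucasSeq]
    ring

theorem lucasSeq_add (a : ℤ) (m n : ℕ) :
    lucasSeq a 1 (m + n) = lucasSeq a 1 n * lucasSeq a 1 (m + 1) +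
      (lucasSeq a 1 (n + 1) - a * lucasSeq a 1 n) * lucasSeq a 1 m := by
  cases n with
  | zero => simp [lucasSeq]
  | succ n =>
    rw [← add_assoc, lucasSeq_add_succ]
    simp only [lucasSeq]
    ring

theorem isCoprime_lucasSeq_succ (a : ℤ) (n : ℕ) :
    IsCoprime (lucasSeq a 1 n) (lucasSeq a 1 (n + 1)) := by
  induction n with
  | zero => exact isCoprime_one_right
  | succ n ih =>
    simpa [lucasSeq, add_comm, mul_comm] using
      (IsCoprime.add_mul_left_right ih.symm a)

theorem Prime.not_dvd_lucasSeq_succ {q : ℤ} (hq : Prime q) {a : ℤ} {n : ℕ}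
    (h : q ∣ lucasSeq a 1 n) : ¬ q ∣ lucasSeq a 1 (n + 1) := fun h' =>
  hq.not_isUnit ((isCoprime_lucasSeq_succ a n).isUnit_of_dvd' h h')

theorem lucasSeq_dvd_lucasSeq_mul (a : ℤ) (n m : ℕ) :
    lucasSeq a 1 n ∣ lucasSeq a 1 (m * n) := by
  induction m with
  | zero => simp [lucasSeq]
  | succ m ih =>
    rw [Nat.succ_mul, lucasSeq_add]
    exact dvd_add (dvd_mul_right _ _) (ih.mul_left _)

/-- The term of index `m * n + 1` modulo the square of the term of index `n`. -/
theorem sq_dvd_lucasSeq_mul_succ_sub (a : ℤ) (n m : ℕ) :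
    lucasSeq a 1 n ^ 2 ∣ lucasSeq a 1 (m * n + 1) - lucasSeq a 1 (n + 1) ^ m := by
  induction m with
  | zero => simp [lucasSeq]
  | succ m ih =>
    obtain ⟨u, hu⟩ := ih
    obtain ⟨v, hv⟩ := lucasSeq_dvd_lucasSeq_mul a n m
    rw [Nat.succ_mul, lucasSeq_add_succ, hv, sub_eq_iff_eq_add.mp hu]
    exact ⟨u * lucasSeq a 1 (n + 1) + v, by ring⟩

/-- The term of index `m * n` modulo the cube of the term of index `n`. -/
theorem cube_dvd_lucasSeq_mul_sub (a : ℤ) (n m : ℕ) :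
    lucasSeq a 1 n ^ 3 ∣ 2 * lucasSeq a 1 (n + 1) ^ 2 * lucasSeq a 1 (m * n) -
      (2 * m * lucasSeq a 1 n * lucasSeq a 1 (n + 1) ^ (m + 1) -
        a * m * (m - 1) * lucasSeq a 1 n ^ 2 * lucasSeq a 1 (n + 1) ^ m) := by
  -- With `A = L_n`, `B = L_{n+1}` and roots `θ, θ'`, one has `θ^n = B - A θ'`. The subtracted terms
  -- come from expanding the `m`-th power to order two, scaled by `2 B ^ 2` to clear the binomial's
  -- 2 and negative powers of `B`.
  induction m with
  | zero => simp [lucasSeq]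
  | succ m ih =>
    obtain ⟨u, hu⟩ := ih
    obtain ⟨v, hv⟩ := sq_dvd_lucasSeq_mul_succ_sub a n m
    rw [Nat.succ_mul, lucasSeq_add a (m * n) n, sub_eq_iff_eq_add.mp hv]
    refine ⟨2 * lucasSeq a 1 (n + 1) ^ 2 * v + (lucasSeq a 1 (n + 1) - a * lucasSeq a 1 n) * u +
      a ^ 2 * m * (m - 1) * lucasSeq a 1 (n + 1) ^ m, ?_⟩
    push_cast
    linear_combination (lucasSeq a 1 (n + 1) - a * lucasSeq a 1 n) * hu

/-! ### Powers of `p` dividing `L_{p^j n}`, and digitwise approximation -/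

/-- In the expansion of `L_{pn}` the linear term has valuation exactly `e + 1`, while the quadratic
one has at least `2e + 1` and the remainder at least `3e`, both at least `e + 2`. A remainder of
order `2e` would not suffice for `e = 1`. -/
theorem pow_dvd_lucasSeq_prime_mul {p : ℕ} (hp : p.Prime) (h2 : p ≠ 2) {a : ℤ} {n e : ℕ}
    (he : 1 ≤ e) (h : (p : ℤ) ^ e ∣ lucasSeq a 1 n) (h' : ¬ (p : ℤ) ^ (e + 1) ∣ lucasSeq a 1 n) :
    (p : ℤ) ^ (e + 1) ∣ lucasSeq a 1 (p * n) ∧ ¬ (p : ℤ) ^ (e + 2) ∣ lucasSeq a 1 (p * n) := by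
  have hq : Prime (p : ℤ) := Nat.prime_iff_prime_int.mp hp
  have hp2 : ¬ (p : ℤ) ∣ 2 := fun hd =>
    h2 ((Nat.prime_dvd_prime_iff_eq hp Nat.prime_two).mp (by exact_mod_cast hd))
  have hB : ¬ (p : ℤ) ∣ lucasSeq a 1 (n + 1) :=
    hq.not_dvd_lucasSeq_succ ((dvd_pow_self _ (by omega)).trans h)
  obtain ⟨z, hz⟩ := cube_dvd_lucasSeq_mul_sub a n p
  obtain ⟨f, rfl⟩ : ∃ f, e = f + 1 := ⟨e - 1, by omega⟩
  obtain ⟨A, hA⟩ := h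
  have hA' : ¬ (p : ℤ) ∣ A := by
    rintro ⟨w, rfl⟩
    exact h' ⟨w, by rw [hA]; ring⟩
  rw [hA] at hz
  set B := lucasSeq a 1 (n + 1)
  set X := lucasSeq a 1 (p * n)
  have hcop : ∀ k, IsCoprime ((p : ℤ) ^ k) (2 * B ^ 2) := fun k => by
    refine IsCoprime.pow_left (IsCoprime.mul_right ?_ (IsCoprime.pow_right ?_))
    · exact (hq.irreducible.coprime_iff_not_dvd).mpr hp2
    · exact (hq.irreducible.coprime_iff_not_dvd).mpr hB
  constructor
  · refine (hcop _).dvd_of_dvd_mul_left ⟨2 * A * B ^ (p + 1) -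
      a * (p - 1) * p ^ (f + 1) * A ^ 2 * B ^ p + p ^ (2 * f + 1) * A ^ 3 * z, ?_⟩
    linear_combination hz
  · rintro ⟨w, hw⟩
    have : (p : ℤ) ∣ 2 * A * B ^ (p + 1) := by
      refine ⟨2 * B ^ 2 * w + a * (p - 1) * p ^ f * A ^ 2 * B ^ p - p ^ (2 * f) * A ^ 3 * z, ?_⟩
      have h0 : (p : ℤ) ^ (f + 2) ≠ 0 := pow_ne_zero _ hq.ne_zero
      apply mul_left_cancel₀ h0
      rw [hw] at hz
      linear_combination -hz
    rcases hq.dvd_or_dvd this with h1 | h1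
    · rcases hq.dvd_or_dvd h1 with h1 | h1
      · exact hp2 h1
      · exact hA' h1
    · exact hB (hq.dvd_of_dvd_pow h1)

theorem pow_dvd_lucasSeq_prime_pow_mul {p : ℕ} (hp : p.Prime) (h2 : p ≠ 2) {a : ℤ} {n : ℕ}
    (h : (p : ℤ) ∣ lucasSeq a 1 n) (h' : ¬ (p : ℤ) ^ 2 ∣ lucasSeq a 1 n) (j : ℕ) :
    (p : ℤ) ^ (j + 1) ∣ lucasSeq a 1 (p ^ j * n) ∧
      ¬ (p : ℤ) ^ (j + 2) ∣ lucasSeq a 1 (p ^ j * n) := by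
  induction j with
  | zero => simpa using ⟨h, h'⟩
  | succ j ih =>
    rw [pow_succ' p j, mul_assoc]
    exact pow_dvd_lucasSeq_prime_mul hp h2 (by omega) ih.1 ih.2

/-- If `p` divides `L_n` exactly once, then the quotients `L_{kn} / L_{kn+1}` represent every
multiple of `p` modulo every power of `p`. -/
theorem exists_pow_dvd_lucasSeq_sub {p : ℕ} (hp : p.Prime) (h2 : p ≠ 2) {a : ℤ} {n : ℕ}
    (h : (p : ℤ) ∣ lucasSeq a 1 n) (h' : ¬ (p : ℤ) ^ 2 ∣ lucasSeq a 1 n) {s : ℤ}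
    (hs : (p : ℤ) ∣ s) (N : ℕ) :
    ∃ k : ℕ, (p : ℤ) ^ (N + 1) ∣ lucasSeq a 1 (k * n) - s * lucasSeq a 1 (k * n + 1) := by
  have hq : Prime (p : ℤ) := Nat.prime_iff_prime_int.mp hp
  induction N with
  | zero => exact ⟨0, by simpa [lucasSeq] using hs⟩
  | succ N ih =>
    obtain ⟨k, w, hw⟩ := ih
    obtain ⟨⟨A, hA⟩, hN'⟩ := pow_dvd_lucasSeq_prime_pow_mul hp h2 h h' N
    have hA' : ¬ (p : ℤ) ∣ A := by
      rintro ⟨v, rfl⟩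
      exact hN' ⟨v, by rw [hA]; ring⟩
    have hB := hq.not_dvd_lucasSeq_succ (dvd_of_mul_right_eq (p ^ N * A : ℤ) (by rw [hA]; ring))
    have hY := hq.not_dvd_lucasSeq_succ (h.trans (lucasSeq_dvd_lucasSeq_mul a n k))
    obtain ⟨x, hx⟩ := h.trans (lucasSeq_dvd_lucasSeq_mul a n k)
    obtain ⟨s, rfl⟩ := hs
    set m := p ^ N * n
    set B := lucasSeq a 1 (m + 1)
    set Y := lucasSeq a 1 (k * n + 1)
    have hcop : IsCoprime (p : ℤ) (A * Y) :=
      IsCoprime.mul_right ((hq.irreducible.coprime_iff_not_dvd).mpr hA')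
        ((hq.irreducible.coprime_iff_not_dvd).mpr hY)
    obtain ⟨u, v, huv⟩ := hcop
    have hp0 : (p : ℤ) ≠ 0 := hq.ne_zero
    -- Hensel-style correction: adding `c * m` to the index shifts the error by a multiple of `p ^
    -- (N + 1)` linear in `c` modulo `p ^ (N + 2)`, and `c` is chosen to cancel the next digit. Here
    -- `v` inverts `A * Y` modulo `p`.
    obtain ⟨c, hc⟩ : ∃ c : ℕ, (p : ℤ) ∣ B * w + c * (A * Y) := by
      refine ⟨((-(B * w * v)) % p).toNat, ?_⟩
      rw [Int.toNat_of_nonneg (Int.emod_nonneg _ hp0), Int.emod_def]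
      exact ⟨B * w * u - (-(B * w * v) / p) * (A * Y), by linear_combination (-B * w) * huv⟩
    have key : ∀ c : ℕ, (p : ℤ) ∣ lucasSeq a 1 (k * n + c * m) ∧
        (p : ℤ) ^ (N + 1) ∣ lucasSeq a 1 (k * n + c * m + 1) - B ^ c * Y ∧
        (p : ℤ) ^ (N + 2) ∣ B * (lucasSeq a 1 (k * n + c * m) -
          p * s * lucasSeq a 1 (k * n + c * m + 1)) -
            B ^ c * p ^ (N + 1) * (B * w + c * (A * Y)) := by
      intro c
      induction c with
      | zero =>
        refine ⟨⟨x, by simpa using hx⟩, by simp [Y], ⟨0, ?_⟩⟩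
        simp only [zero_mul, add_zero]
        push_cast
        linear_combination B * hw
      | succ c ih =>
        obtain ⟨⟨x, hx⟩, ⟨y, hy⟩, ⟨z, hz⟩⟩ := ih
        rw [Nat.succ_mul, ← add_assoc, lucasSeq_add_succ, lucasSeq_add a (k * n + c * m) m, hA]
        change (p : ℤ) ∣ _ + (B - _) * _ ∧ _ ∣ _ * B + _ - _ ∧ _ ∣ B * (_ + (B - _) * _ -
          _ * (_ * B + _)) - _
        generalize lucasSeq a 1 (k * n + c * m) = X at *
        generalize lucasSeq a 1 (k * n + c * m + 1) = Z at *
        subst hx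
        obtain rfl := sub_eq_iff_eq_add.mp hy
        refine ⟨⟨p ^ N * A * (p ^ (N + 1) * y + B ^ c * Y) + (B - a * (p ^ (N + 1) * A)) * x,
          by ring⟩, ⟨B * y + p * x * A, by ring⟩, ?_⟩
        refine ⟨B * z + B * A * (p ^ N * y - a * x - p * s * x), ?_⟩
        push_cast
        linear_combination B * hz
    obtain ⟨d, hd⟩ := hc
    obtain ⟨-, -, hE⟩ := key c
    rw [hd] at hE
    refine ⟨k + c * p ^ N, ?_⟩
    rw [show (k + c * p ^ N) * n = k * n + c * m by simp only [m]; ring]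
    have hcopB : IsCoprime ((p : ℤ) ^ (N + 2)) B :=
      ((hq.irreducible.coprime_iff_not_dvd).mpr hB).pow_left
    refine hcopB.dvd_of_dvd_mul_left ((dvd_sub_left ⟨B ^ c * d, by ring⟩).mp hE)

/-! ### The rank of appearance, and primes dividing the discriminant -/

theorem rankOfAppearance_spec {u : ℕ → ℤ} {p : ℕ} (h : rankOfAppearance u p ≠ 0) :
    (p : ℤ) ∣ u (rankOfAppearance u p) :=
  (Nat.sInf_mem (Nat.nonempty_of_pos_sInf (Nat.pos_of_ne_zero h))).2

theorem rankOfAppearance_le {u : ℕ → ℤ} {p n : ℕ} (h0 : 0 < n) (h : (p : ℤ) ∣ u n) :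
    rankOfAppearance u p ≤ n :=
  Nat.sInf_le ⟨h0, h⟩

/-- First two terms of `2^(n-1) L_n = ∑ C(n, 2j+1) a^(n-2j-1) D^j`, multiplied by `6 a ^ 3` to clear
denominators and negative exponents. -/
theorem sq_lucasDisc_dvd (a : ℤ) (n : ℕ) :
    lucasDisc a 1 ^ 2 ∣ 3 * a ^ 3 * (2 ^ n * lucasSeq a 1 n) -
      (6 * n * a ^ (n + 2) + n * (n - 1) * (n - 2) * a ^ n * lucasDisc a 1) := by
  induction n using Nat.twoStepInduction with
  | zero => simp [lucasSeq]
  | one => exact ⟨0, by simp [lucasSeq]; ring⟩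
  | more n ih ih' =>
    obtain ⟨u, hu⟩ := ih
    obtain ⟨v, hv⟩ := ih'
    refine ⟨2 * a * v + 4 * u + n * (n - 1) * (n - 2) * a ^ n, ?_⟩
    have hD : (4 : ℤ) = lucasDisc a 1 - a ^ 2 := by simp [lucasDisc]
    rw [lucasSeq]
    push_cast at hv ⊢
    linear_combination 2 * a * hv + 4 * hu +
      (6 * n * a ^ (n + 2) + n * (n - 1) * (n - 2) * a ^ n * lucasDisc a 1) * hD

/-- Here `p ∤ 6a`, so modulo `p` the term `L_n` is a unit times `n`, and the rank is `p` itself. At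
`n = p` the `D` term carries a second factor `p`, so only `6 p a^(p+2)` survives modulo `p ^ 2`. -/
theorem not_sq_dvd_lucasSeq_of_dvd_lucasDisc {p : ℕ} (hp : p.Prime) (h2 : p ≠ 2) {a : ℤ}
    (hD : (p : ℤ) ∣ lucasDisc a 1) (hr : 2 < rankOfAppearance (lucasSeq a 1) p) :
    ¬ (p : ℤ) ^ 2 ∣ lucasSeq a 1 (rankOfAppearance (lucasSeq a 1) p) := by
  have hq : Prime (p : ℤ) := Nat.prime_iff_prime_int.mp hp
  have hcop : ∀ q : ℕ, q.Prime → p ≠ q → ¬ (p : ℤ) ∣ q := fun q hq hne hd =>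
    hne ((Nat.prime_dvd_prime_iff_eq hp hq).mp (by exact_mod_cast hd))
  have hp2 : ¬ (p : ℤ) ∣ 2 := hcop 2 Nat.prime_two h2
  have h3 : p ≠ 3 := by
    rintro rfl
    have : a % 3 = 0 ∨ a % 3 = 1 ∨ a % 3 = 2 := by omega
    have h0 := Int.emod_eq_zero_of_dvd hD
    rcases this with h | h | h <;> simp [lucasDisc, Int.add_emod, pow_two, Int.mul_emod, h] at h0
  have hp3 : ¬ (p : ℤ) ∣ 3 := hcop 3 Nat.prime_three h3
  have ha : ¬ (p : ℤ) ∣ a := by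
    rintro h
    have : (p : ℤ) ∣ 2 ^ 2 := by
      have := dvd_sub hD (h.mul_right a)
      rwa [show lucasDisc a 1 - a * a = 2 ^ 2 by simp [lucasDisc]; ring] at this
    exact hp2 (hq.dvd_of_dvd_pow this)
  have hr0 : rankOfAppearance (lucasSeq a 1) p ≠ 0 := by omega
  have hdvd := rankOfAppearance_spec hr0
  have hle : ∀ n, 0 < n → (p : ℤ) ∣ lucasSeq a 1 n → rankOfAppearance (lucasSeq a 1) p ≤ n :=
    fun n => rankOfAppearance_le
  generalize rankOfAppearance (lucasSeq a 1) p = r at *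
  obtain ⟨d, hd⟩ := hD
  have hpr : p ∣ r := by
    obtain ⟨z, hz⟩ := sq_lucasDisc_dvd a r
    obtain ⟨y, hy⟩ := hdvd
    have h6 : (p : ℤ) ∣ 2 * 3 * r * a ^ (r + 2) := by
      rw [hd, hy] at hz
      exact ⟨3 * a ^ 3 * (2 ^ r * y) - r * (r - 1) * (r - 2) * a ^ r * d - p * d ^ 2 * z,
        by linear_combination -hz⟩
    rcases hq.dvd_or_dvd h6 with h | h
    · rcases hq.dvd_or_dvd h with h | h
      · rcases hq.dvd_or_dvd h with h | h
        · exact absurd h hp2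
        · exact absurd h hp3
      · exact_mod_cast h
    · exact absurd (hq.dvd_of_dvd_pow h) ha
  obtain ⟨z, hz⟩ := sq_lucasDisc_dvd a p
  rw [hd] at hz
  have hpL : (p : ℤ) ∣ lucasSeq a 1 p := by
    have : (p : ℤ) ∣ 3 * a ^ 3 * 2 ^ p * lucasSeq a 1 p :=
      ⟨6 * a ^ (p + 2) + (p - 1) * (p - 2) * a ^ p * (p * d) + p * d ^ 2 * z,
        by linear_combination hz⟩
    refine (hq.dvd_or_dvd this).resolve_left fun h => ?_
    rcases hq.dvd_or_dvd h with h | h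
    · rcases hq.dvd_or_dvd h with h | h
      · exact hp3 h
      · exact ha (hq.dvd_of_dvd_pow h)
    · exact hp2 (hq.dvd_of_dvd_pow h)
  obtain rfl : r = p := le_antisymm (hle p hp.pos hpL) (Nat.le_of_dvd (by omega) hpr)
  rintro ⟨w, hw⟩
  rw [hw] at hz
  have h6 : (r : ℤ) ∣ 2 * 3 * a ^ (r + 2) := by
    refine ⟨3 * a ^ 3 * 2 ^ r * w - (r - 1) * (r - 2) * a ^ r * d - d ^ 2 * z, ?_⟩
    apply mul_left_cancel₀ hq.ne_zero
    linear_combination -hz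
  rcases hq.dvd_or_dvd h6 with h | h
  · rcases hq.dvd_or_dvd h with h | h
    · exact hp2 h
    · exact hp3 h
  · exact ha (hq.dvd_of_dvd_pow h)

/-! ### Roots in the algebraic closure, and primes not dividing the discriminant -/

theorem PadicAlgCl.norm_intCast (p : ℕ) [Fact p.Prime] (z : ℤ) :
    ‖(z : PadicAlgCl p)‖ = ‖(z : ℚ_[p])‖ := by
  rw [← PadicAlgCl.norm_extends, map_intCast]

theorem lucasCharpoly_roots {K : Type*} [Field K] [CharZero K] {a b : ℤ} {x y : K}
    (h : (lucasCharpoly a b).aroots K = {x, y}) : x + y = a ∧ x * y = -b := by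
  have hq : (lucasCharpoly a b).map (algebraMap ℤ K) =
      Polynomial.C 1 * Polynomial.X ^ 2 + Polynomial.C (-a : K) * Polynomial.X +
        Polynomial.C (-b : K) := by
    simp [lucasCharpoly]; ring
  have hdeg : ((lucasCharpoly a b).map (algebraMap ℤ K)).natDegree = 2 := by
    rw [hq, Polynomial.natDegree_quadratic one_ne_zero]
  have hmonic : ((lucasCharpoly a b).map (algebraMap ℤ K)).Monic := by
    rw [Polynomial.Monic, hq, Polynomial.leadingCoeff_quadratic one_ne_zero]
  have hprod := Polynomial.prod_multiset_X_sub_C_of_monic_of_roots_card_eq hmonic (by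
    rw [hdeg, ← Polynomial.aroots_def, h]; rfl)
  rw [← Polynomial.aroots_def, h, hq] at hprod
  have h0 := congrArg (Polynomial.eval 0) hprod
  have h1 := congrArg (Polynomial.eval 1) hprod
  simp at h0 h1
  exact ⟨by linear_combination h0 - h1, h0⟩

theorem lucasSeq_mul_sub {K : Type*} [Field K] {a b : ℤ} {x y : K}
    (hs : x + y = a) (hm : x * y = -b) (n : ℕ) :
    (lucasSeq a b n : K) * (x - y) = x ^ n - y ^ n := by
  induction n using Nat.twoStepInduction with
  | zero => simp [lucasSeq]
  | one => simp [lucasSeq]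
  | more n ih ih' =>
    have hb : (b : K) = -(x * y) := by rw [hm, neg_neg]
    rw [lucasSeq]
    push_cast
    rw [← hs, hb]
    linear_combination (x + y) * ih' - x * y * ih

theorem PadicAlgCl.norm_eq_one_of_mul_eq_neg_one {p : ℕ} [Fact p.Prime] {a : ℤ}
    {x y : PadicAlgCl p} (hs : x + y = a) (hm : x * y = -1) : ‖x‖ = 1 := by
  have ha : ‖x + y‖ ≤ 1 := by
    rw [hs, PadicAlgCl.norm_intCast]; exact Padic.norm_int_le_one a
  have hn : ‖x‖ * ‖y‖ = 1 := by rw [← norm_mul, hm]; simp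
  by_contra hne
  have hxy : ‖x‖ ≠ ‖y‖ := fun h => by
    rw [← h] at hn
    linarith [norm_nonneg x, (mul_self_eq_one_iff.mp hn).resolve_left hne]
  rw [IsUltrametricDist.norm_add_eq_max_of_norm_ne_norm hxy] at ha
  have h1 := le_of_max_le_left ha
  have h2 := le_of_max_le_right ha
  exact hne (le_antisymm h1 (by nlinarith [norm_nonneg x, norm_nonneg y]))

theorem intDvd_iff {p : ℕ} [Fact p.Prime] {K : IntermediateField ℚ_[p] (PadicAlgCl p)}
    {x y : PadicAlgCl p} (hx : x ∈ K) (hy : y ∈ K) (h0 : x ≠ 0) :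
    IntDvd K x y ↔ ‖y‖ ≤ ‖x‖ := by
  constructor
  · rintro ⟨z, -, hz, rfl⟩
    rw [norm_mul]
    exact mul_le_of_le_one_right (norm_nonneg x) hz
  · intro h
    refine ⟨y / x, div_mem hy hx, ?_, (mul_div_cancel₀ y h0).symm⟩
    rw [norm_div]
    exact div_le_one_of_le₀ h (norm_nonneg x)

theorem not_sq_dvd_lucasSeq_of_not_intDvd {p : ℕ} [Fact p.Prime] {a : ℤ}
    (hD : ¬ (p : ℤ) ∣ lucasDisc a 1) (hr : rankOfAppearance (lucasSeq a 1) p ≠ 0)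
    {x y π : PadicAlgCl p} (hroots : (lucasCharpoly a 1).aroots (PadicAlgCl p) = {x, y})
    (hπ : IsQuadUniformizer (quadField p (lucasDisc a 1)) π)
    (h : ¬ IntDvd (quadField p (lucasDisc a 1)) (π ^ 2)
      ((y / x) ^ orderModulo (quadField p (lucasDisc a 1)) π (y / x) - 1)) :
    ¬ (p : ℤ) ^ 2 ∣ lucasSeq a 1 (rankOfAppearance (lucasSeq a 1) p) := by
  intro hsq
  obtain ⟨hs, hm⟩ := lucasCharpoly_roots hroots
  rw [Int.cast_one] at hm
  have hnx : ‖x‖ = 1 := PadicAlgCl.norm_eq_one_of_mul_eq_neg_one hs hm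
  have hx0 : x ≠ 0 := norm_ne_zero_iff.mp (by rw [hnx]; exact one_ne_zero)
  have hdisc : (x - y) ^ 2 = (lucasDisc a 1 : PadicAlgCl p) := by
    simp only [lucasDisc]
    push_cast
    rw [← hs]
    linear_combination -4 * hm
  have hnxy : ‖x - y‖ = 1 := by
    have h1 : ‖x - y‖ ^ 2 = 1 := by
      rw [← norm_pow, hdisc, PadicAlgCl.norm_intCast]
      refine le_antisymm (Padic.norm_int_le_one _) (not_lt.mp fun hlt => hD ?_)
      exact Padic.norm_intCast_lt_one_iff.mp hlt
    exact (pow_eq_one_iff_of_nonneg (norm_nonneg _) two_ne_zero).mp h1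
  have hnorm : ∀ n, ‖(y / x) ^ n - 1‖ = ‖(lucasSeq a 1 n : ℚ_[p])‖ := fun n => by
    have h1 : (y / x) ^ n - 1 = -(lucasSeq a 1 n * (x - y)) / x ^ n := by
      rw [lucasSeq_mul_sub hs (by simpa using hm), eq_div_iff (pow_ne_zero n hx0), div_pow,
        sub_mul, div_mul_cancel₀ _ (pow_ne_zero n hx0)]
      ring
    rw [h1, norm_div, norm_neg, norm_mul, norm_pow, hnx, hnxy, PadicAlgCl.norm_intCast]
    simp
  set K := quadField p (lucasDisc a 1)
  have hsub : x - y ∈ K := IntermediateField.subset_adjoin _ _ hdisc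
  have hxK : x ∈ K := by
    have h2 : x = ((a : PadicAlgCl p) + (x - y)) / 2 := by rw [← hs]; ring
    rw [h2]
    exact div_mem (add_mem (intCast_mem K a) hsub) (ofNat_mem K 2)
  have hyK : y ∈ K := by simpa using sub_mem hxK hsub
  have hmem : ∀ n, (y / x) ^ n - 1 ∈ K := fun n =>
    sub_mem (pow_mem (div_mem hyK hxK) n) (one_mem K)
  obtain ⟨hπK, hram, hunram⟩ := hπ
  have hp1 : (1 : ℝ) < p := by exact_mod_cast (Fact.out : p.Prime).one_lt
  have hinv : (p : ℝ)⁻¹ < 1 := inv_lt_one_of_one_lt₀ hp1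
  have hinv0 : 0 < (p : ℝ)⁻¹ := by positivity
  -- These two bounds are all that is needed of `π`, ramified or not.
  have hπn : ‖π‖ < 1 ∧ (p : ℝ)⁻¹ ≤ ‖π‖ := by
    by_cases hK : IsRamifiedQuad K
    · have := hram hK
      constructor
      · by_contra hge
        nlinarith
      · by_contra hlt
        nlinarith [norm_nonneg π]
    · have : ‖π‖ = (p : ℝ)⁻¹ := by
        rw [hunram hK]
        have := PadicAlgCl.norm_intCast p p
        rwa [Int.cast_natCast, Int.cast_natCast, Padic.norm_p] at this
      rw [this]
      exact ⟨hinv, le_rfl⟩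
  have hπ0 : π ≠ 0 := norm_ne_zero_iff.mp (by linarith)
  set r := rankOfAppearance (lucasSeq a 1) p
  have hr2 : ‖(lucasSeq a 1 r : ℚ_[p])‖ ≤ ‖π ^ 2‖ := by
    have h1 := (Padic.norm_int_le_pow_iff_dvd (p := p) _ 2).mpr (by exact_mod_cast hsq)
    refine h1.trans ?_
    rw [norm_pow, zpow_neg, ← inv_zpow]
    exact pow_le_pow_left₀ hinv0.le hπn.2 2
  have hr1 : IntDvd K π ((y / x) ^ r - 1) := by
    rw [intDvd_iff hπK (hmem r) hπ0, hnorm]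
    refine hr2.trans ?_
    rw [norm_pow]
    nlinarith
  have hl : orderModulo K π (y / x) = r := by
    refine le_antisymm (Nat.sInf_le ⟨Nat.pos_of_ne_zero hr, hr1⟩) ?_
    have hne : {l : ℕ | 0 < l ∧ IntDvd K π ((y / x) ^ l - 1)}.Nonempty :=
      ⟨r, Nat.pos_of_ne_zero hr, hr1⟩
    obtain ⟨hl0, hl⟩ := Nat.sInf_mem hne
    refine rankOfAppearance_le hl0 (Padic.norm_intCast_lt_one_iff.mp ?_)
    rw [← hnorm]
    exact ((intDvd_iff hπK (hmem _) hπ0).mp hl).trans_lt hπn.1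
  apply h
  rw [hl, intDvd_iff (pow_mem hπK 2) (hmem r) (pow_ne_zero 2 hπ0), hnorm]
  exact hr2

/-! ### Density of the quotients -/

theorem mem_closure_range_lucasSeq_div {p : ℕ} [Fact p.Prime] (h2 : p ≠ 2) {a : ℤ} {n : ℕ}
    (h : (p : ℤ) ∣ lucasSeq a 1 n) (h' : ¬ (p : ℤ) ^ 2 ∣ lucasSeq a 1 n) {t : ℚ_[p]}
    (ht : ‖t‖ < 1) :
    t ∈ closure (Set.range fun k : ℕ =>
      (lucasSeq a 1 (k * n) : ℚ_[p]) / (lucasSeq a 1 (k * n + 1) : ℚ_[p])) := by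
  have hp : p.Prime := Fact.out
  have hq : Prime (p : ℤ) := Nat.prime_iff_prime_int.mp hp
  rw [Metric.mem_closure_range_iff]
  intro ε hε
  obtain ⟨N, hN⟩ : ∃ N : ℕ, (p : ℝ) ^ (-(N : ℤ)) < ε := by
    have hp1 : (1 : ℝ) < p := by exact_mod_cast hp.one_lt
    obtain ⟨N, hN⟩ := exists_pow_lt_of_lt_one hε (inv_lt_one_of_one_lt₀ hp1)
    exact ⟨N, by simpa using hN⟩
  obtain ⟨x, rfl⟩ : ∃ x : ℤ_[p], (x : ℚ_[p]) = t := ⟨⟨t, ht.le⟩, rfl⟩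
  obtain ⟨s, hs⟩ := (PadicInt.denseRange_intCast (p := p)).exists_dist_lt x (lt_min hε one_pos)
  have hs' : ‖(x : ℚ_[p]) - s‖ < min ε 1 := by
    rw [dist_eq_norm, PadicInt.norm_def] at hs
    simpa only [PadicInt.coe_sub, PadicInt.coe_intCast] using hs
  have hps : (p : ℤ) ∣ s := by
    rw [← Padic.norm_intCast_lt_one_iff, show (s : ℚ_[p]) = x + -((x : ℚ_[p]) - s) by ring]
    exact (IsUltrametricDist.norm_add_le_max _ _).trans_lt
      (max_lt ht ((norm_neg ((x : ℚ_[p]) - s)).trans_lt <| hs'.trans_le (min_le_right _ _)))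
  obtain ⟨k, hk⟩ := exists_pow_dvd_lucasSeq_sub hp h2 h h' hps N
  refine ⟨k, ?_⟩
  have hY : ‖(lucasSeq a 1 (k * n + 1) : ℚ_[p])‖ = 1 := by
    refine le_antisymm (Padic.norm_int_le_one _) (not_lt.mp fun hlt => ?_)
    exact hq.not_dvd_lucasSeq_succ (h.trans (lucasSeq_dvd_lucasSeq_mul a n k))
      (Padic.norm_intCast_lt_one_iff.mp hlt)
  have hY0 : (lucasSeq a 1 (k * n + 1) : ℚ_[p]) ≠ 0 :=
    norm_ne_zero_iff.mp (by rw [hY]; exact one_ne_zero)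
  have hE : ‖(s : ℚ_[p]) - lucasSeq a 1 (k * n) / lucasSeq a 1 (k * n + 1)‖ < ε := by
    have h1 : (s : ℚ_[p]) - lucasSeq a 1 (k * n) / lucasSeq a 1 (k * n + 1) =
        -((lucasSeq a 1 (k * n) - s * lucasSeq a 1 (k * n + 1) : ℤ) : ℚ_[p]) /
          lucasSeq a 1 (k * n + 1) := by
      push_cast
      field_simp
      ring
    rw [h1, norm_div, norm_neg, hY, div_one]
    refine lt_of_le_of_lt ((Padic.norm_int_le_pow_iff_dvd _ N).mpr ?_) hN
    exact_mod_cast (pow_dvd_pow (p : ℤ) N.le_succ).trans hk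
  rw [dist_eq_norm, ← sub_add_sub_cancel (x : ℚ_[p]) (s : ℚ_[p])]
  exact (IsUltrametricDist.norm_add_le_max _ _).trans_lt (max_lt (hs'.trans_le (min_le_left _ _)) hE)

open Filter Topology in
/-- If the rank of appearance `r` of `p` is at least `3` and `p` divides `L_r` exactly once, then
the quotients `L_{n+r} / L_n` and `L_{n+r-2} / L_n` together are dense. -/
theorem ratioClosure_union_eq_univ {p : ℕ} [Fact p.Prime] (h2 : p ≠ 2) {a : ℤ}
    (hr : 2 < rankOfAppearance (lucasSeq a 1) p)
    (hsq : ¬ (p : ℤ) ^ 2 ∣ lucasSeq a 1 (rankOfAppearance (lucasSeq a 1) p)) :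
    ratioClosure p (lucasSeq a 1) (rankOfAppearance (lucasSeq a 1) p) ∪
      ratioClosure p (lucasSeq a 1) (rankOfAppearance (lucasSeq a 1) p - 2) = Set.univ := by
  have hq : Prime (p : ℤ) := Nat.prime_iff_prime_int.mp Fact.out
  have hdvd := rankOfAppearance_spec (show rankOfAppearance (lucasSeq a 1) p ≠ 0 by omega)
  have hmin : ∀ n, 0 < n → n < rankOfAppearance (lucasSeq a 1) p → ¬ (p : ℤ) ∣ lucasSeq a 1 n :=
    fun n h0 hn h => absurd (rankOfAppearance_le h0 h) (not_le.mpr hn)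
  generalize rankOfAppearance (lucasSeq a 1) p = R at *
  obtain ⟨r, rfl⟩ : ∃ r, R = r + 2 := ⟨_, (Nat.sub_add_cancel hr.le).symm⟩
  rw [Nat.add_sub_cancel]
  have hdense := fun t : ℚ_[p] => mem_closure_range_lucasSeq_div h2 hdvd hsq (t := t)
  set c : ℚ_[p] := (lucasSeq a 1 (r + 1) : ℚ_[p])
  have hY0 : ∀ k : ℕ, lucasSeq a 1 (k * (r + 2) + 1) ≠ 0 := fun k h0 =>
    hq.not_dvd_lucasSeq_succ (hdvd.trans (lucasSeq_dvd_lucasSeq_mul a _ k)) (h0 ▸ dvd_zero _)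
  rw [Set.eq_univ_iff_forall]
  intro y
  by_cases hy : ‖y - c‖ < 1
  · right
    have hr0 : ‖(lucasSeq a 1 r : ℚ_[p])‖ = 1 := by
      refine le_antisymm (Padic.norm_int_le_one _) (not_lt.mp fun hlt => ?_)
      exact hmin r (by omega) (by omega) (Padic.norm_intCast_lt_one_iff.mp hlt)
    have hne : (lucasSeq a 1 r : ℚ_[p]) ≠ 0 := norm_ne_zero_iff.mp (by rw [hr0]; exact one_ne_zero)
    have ht := hdense ((y - c) / lucasSeq a 1 r) (by rwa [norm_div, hr0, div_one])
    have hcont : Continuous fun t : ℚ_[p] => c + lucasSeq a 1 r * t := by fun_prop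
    have := map_mem_closure hcont ht (t := {x : ℚ_[p] | ∃ n : ℕ, lucasSeq a 1 n ≠ 0 ∧
      x = (lucasSeq a 1 (n + r) : ℚ_[p]) / (lucasSeq a 1 n : ℚ_[p])}) ?_
    · rwa [mul_div_cancel₀ _ hne, add_sub_cancel] at this
    · rintro _ ⟨k, rfl⟩
      refine ⟨k * (r + 2) + 1, hY0 k, ?_⟩
      have hk : (lucasSeq a 1 (k * (r + 2) + 1) : ℚ_[p]) ≠ 0 := by exact_mod_cast hY0 k
      rw [add_right_comm, lucasSeq_add_succ]
      push_cast
      field_simp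
      simp [c]
      ring
  · left
    have hyc : y - c ≠ 0 := fun h => hy (by simp [h])
    have hA0 : (lucasSeq a 1 (r + 2) : ℚ_[p]) ≠ 0 := by
      have : lucasSeq a 1 (r + 2) ≠ 0 := fun h => hsq (h ▸ dvd_zero _)
      exact_mod_cast this
    -- Solves `c + L_{r+2} / t = y`; since `t ≠ 0`, approximants eventually have `L_{k(r+2)} ≠ 0`.
    set t : ℚ_[p] := lucasSeq a 1 (r + 2) / (y - c)
    have ht0 : t ≠ 0 := div_ne_zero hA0 hyc
    have ht := hdense t (by
      rw [norm_div]
      refine lt_of_le_of_lt (div_le_self (norm_nonneg _) (not_lt.mp hy)) ?_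
      exact Padic.norm_intCast_lt_one_iff.mpr hdvd)
    obtain ⟨u, hu, hlim⟩ := mem_closure_iff_seq_limit.mp ht
    have hlim' : Tendsto (fun n => c + lucasSeq a 1 (r + 2) / u n) atTop (𝓝 y) := by
      have := (tendsto_const_nhds (x := c)).add
        ((tendsto_const_nhds (x := (lucasSeq a 1 (r + 2) : ℚ_[p]))).div hlim ht0)
      rwa [show c + lucasSeq a 1 (r + 2) / t = y by simp only [t]; field_simp; ring] at this
    refine mem_closure_of_tendsto hlim' ?_
    filter_upwards [hlim.eventually_ne ht0] with n hn
    obtain ⟨k, hk⟩ := hu n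
    simp only at hk
    have hX : lucasSeq a 1 (k * (r + 2)) ≠ 0 := fun h => hn (by rw [← hk, h]; simp)
    refine ⟨k * (r + 2), hX, ?_⟩
    have hX' : (lucasSeq a 1 (k * (r + 2)) : ℚ_[p]) ≠ 0 := by exact_mod_cast hX
    have hk0 : (lucasSeq a 1 (k * (r + 2) + 1) : ℚ_[p]) ≠ 0 := by exact_mod_cast hY0 k
    rw [← hk, show k * (r + 2) + (r + 2) = k * (r + 2) + (r + 1) + 1 from rfl,
      lucasSeq_add_succ a (k * (r + 2)) (r + 1)]
    push_cast
    field_simp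
    simp [c]
    ring

/-! ### The Fibonacci case and the conclusion -/

theorem fibSeq_eq_lucasSeq : fibSeq = lucasSeq 1 1 := by
  funext n
  induction n using Nat.twoStepInduction with
  | zero => rfl
  | one => rfl
  | more n ih ih' =>
    rw [lucasSeq, ← ih, ← ih', fibSeq, Nat.fib_add_two]
    simp only [fibSeq]
    push_cast
    ring

theorem mainTheorem4 (p : ℕ) [Fact p.Prime] (hp : 3 ≤ p) :
    (∀ a : ℤ, a ≠ 0 → 2 < rankOfAppearance (lucasSeq a 1) p →
      ∀ lam₁ lam₂ π : PadicAlgCl p,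
        (lucasCharpoly a 1).aroots (PadicAlgCl p) = {lam₁, lam₂} →
        IsQuadUniformizer (quadField p (lucasDisc a 1)) π →
        ((p : ℤ) ^ 2 ∣ lucasDisc a 1 ∨
          ¬ IntDvd (quadField p (lucasDisc a 1)) (π ^ 2)
            ((lam₂ / lam₁) ^
              orderModulo (quadField p (lucasDisc a 1)) π (lam₂ / lam₁) - 1)) →
        ratioClosure p (lucasSeq a 1) (rankOfAppearance (lucasSeq a 1) p) ∪
          ratioClosure p (lucasSeq a 1) (rankOfAppearance (lucasSeq a 1) p - 2) =
            (Set.univ : Set ℚ_[p])) ∧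
    (¬ IsWallSunSun p →
      ratioClosure p fibSeq (rankOfAppearance fibSeq p) ∪
        ratioClosure p fibSeq (rankOfAppearance fibSeq p - 2) =
          (Set.univ : Set ℚ_[p])) := by
  have hpp : p.Prime := Fact.out
  have h2 : p ≠ 2 := by omega
  refine ⟨fun a _ hr x y π hroots hπ h => ratioClosure_union_eq_univ h2 hr ?_, fun hW => ?_⟩
  · by_cases hD : (p : ℤ) ∣ lucasDisc a 1
    · exact not_sq_dvd_lucasSeq_of_dvd_lucasDisc hpp h2 hD hr
    · exact not_sq_dvd_lucasSeq_of_not_intDvd hD (by omega) hroots hπ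
        (h.resolve_left fun h => hD ((dvd_pow_self _ two_ne_zero).trans h))
  · have hsq : ¬ (p : ℤ) ^ 2 ∣ fibSeq (rankOfAppearance fibSeq p) := fun h => hW ⟨hpp, h⟩
    -- The default rank 0 is excluded because `p ^ 2` divides `F_0 = 0`.
    have hr0 : rankOfAppearance fibSeq p ≠ 0 := fun h => hsq (by simp [h, fibSeq])
    have hr : 2 < rankOfAppearance fibSeq p := by
      have hdvd := rankOfAppearance_spec hr0
      have h1 : ¬ (p : ℤ) ∣ 1 := (Nat.prime_iff_prime_int.mp hpp).not_dvd_one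
      by_contra hle
      obtain h | h : rankOfAppearance fibSeq p = 1 ∨ rankOfAppearance fibSeq p = 2 := by omega
      all_goals exact h1 (by simpa [h, fibSeq] using hdvd)
    rw [fibSeq_eq_lucasSeq] at *
    exact ratioClosure_union_eq_univ h2 hr hsq
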